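/- Let $R$ be an associative ring with identity and let $M$ be a left $R$-module. For a submodule $N\le M$ and a left $R$-module $K$ put $N_MK=\sum\{f(N)\mid f\in\mathrm{Hom}_R(M,K)\}$ and $\mathrm{Ann}_M(K)=\bigcap\{\ker f\mid f\in\mathrm{Hom}_R(M,K)\}$. A submodule $N\le M$ is fully invariant if $f(N)\subseteq N$ for every $f\in\mathrm{End}_R(M)$. Let $\sigma[M]$ be the full subcategory of $R$-modules consisting of all modules that embed in an epimorphic image of a direct sum of copies of $M$. Assume that: 1. $M$ is a self-progenerator in $\sigma[M]$, i.e. $M$ is projective in $\sigma[M]$ and every submodule of $M$ is an epimorphic image of a direct sum of copies of $M$ (equivalently, $M$ is a projective generator of $\sigma[M]$); 2. $M$ is semiprime, i.e. $M\neq 0$ and $L_ML=0$ implies $L=0$ for every fully invariant submodule $L$ of $M$; 3. $M$ satisfies the algebraic De Morgan law (DML): $\mathrm{Ann}_M(N\cap L)=\mathrm{Ann}_M(N)+\mathrm{Ann}_M(L)$ for all fully invariant submodules $N,L$ of $M$. Let $\Psi(M)$ be the set of all fully invariant submodules $N$ of $M$ such that $N+\mathrm{Ann}_M(Rn)=M$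 for every $n\in N$, ordered by inclusion. Then $\Psi(M)$ is a frame (a complete lattice in which $a\wedge\bigvee X=\bigvee\{a\wedge x\mid x\in X\}$ for every element $a$ and every subset $X$), and, writing $\neg$ for the pseudocomplement in this frame: (a) $\Psi(M)$ satisfies DML, i.e. $\neg(a\wedge b)=\neg a\vee\neg b$ for all $a,b\in\Psi(M)$; (b) $\Psi(M)$ is a regular frame, i.e. $a=\bigvee\{x\in\Psi(M)\mid a\vee\neg x=1\}$ for every $a\in\Psi(M)$. -/

import Mathlib

universe u v

/-- `N` is `M`-generated: an epimorphic image of a direct sum `M^(X)` of copies of `M`. -/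
def ModGenerated (R : Type u) [Ring R] (M N : Type v) [AddCommGroup M] [Module R M]
    [AddCommGroup N] [Module R N] : Prop :=
  ∃ (X : Type v) (ρ : (X →₀ M) →ₗ[R] N), Function.Surjective ρ

/-- `N` is `M`-subgenerated, i.e. an object of `σ[M]`: it embeds in an `M`-generated module. -/
def ModSubgenerated (R : Type u) [Ring R] (M N : Type v) [AddCommGroup M] [Module R M]
    [AddCommGroup N] [Module R N] : Prop :=
  ∃ (G : Type v) (_ : AddCommGroup G) (_ : Module R G) (i : N →ₗ[R] G),
    ModGenerated R M G ∧ Function.Injective i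

/-- `M` is projective in the full subcategory `σ[M]` of `R`-modules.
(The category `σ[M]` is closed under quotients, so its epimorphisms are the surjective maps.) -/
def ProjectiveInSigma (R : Type u) [Ring R] (M : Type v) [AddCommGroup M] [Module R M] : Prop :=
  ∀ (A B : Type v) [AddCommGroup A] [Module R A] [AddCommGroup B] [Module R B],
    ModSubgenerated R M A → ModSubgenerated R M B →
    ∀ (g : A →ₗ[R] B) (f : M →ₗ[R] B), Function.Surjective g →
      ∃ h : M →ₗ[R] A, g ∘ₗ h = f

/-- `M` is a self-progenerator in `σ[M]`: it is projective in `σ[M]` and generates all of its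
submodules (for `M` projective in `σ[M]` the latter says that `M` is a generator of `σ[M]`). -/
def IsSelfProgenerator (R : Type u) [Ring R] (M : Type v) [AddCommGroup M] [Module R M] : Prop :=
  ProjectiveInSigma R M ∧ ∀ L : Submodule R M, ModGenerated R M L

/-- The product `N_M K = ∑ {f(N) | f ∈ Hom_R(M, K)}` of a submodule `N ≤ M` with a module `K`. -/
def modProd {R : Type u} [Ring R] {M : Type v} [AddCommGroup M] [Module R M]
    (N : Submodule R M) (K : Type v) [AddCommGroup K] [Module R K] : Submodule R K :=
  ⨆ f : M →ₗ[R] K, N.map f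

/-- The product `N_M L` of two submodules of `M`, viewed as a submodule of `M`. -/
def subProd {R : Type u} [Ring R] {M : Type v} [AddCommGroup M] [Module R M]
    (N L : Submodule R M) : Submodule R M :=
  (modProd N L).map L.subtype

/-- A proper fully invariant submodule `N` is semiprime in `M` if `L_M L ≤ N` implies `L ≤ N`
for all fully invariant submodules `L`. -/
def IsSemiprimeIn {R : Type u} [Ring R] {M : Type v} [AddCommGroup M] [Module R M]
    (N : Submodule R M) : Prop :=
  N ≠ ⊤ ∧ N.IsFullyInvariant ∧
    ∀ L : Submodule R M, L.IsFullyInvariant → subProd L L ≤ N → L ≤ N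

/-- `M` is a semiprime module if `0` is semiprime in `M`. -/
def IsSemiprimeModule (R : Type u) [Ring R] (M : Type v) [AddCommGroup M] [Module R M] : Prop :=
  IsSemiprimeIn (⊥ : Submodule R M)

/-- The annihilator `Ann_M(K) = ⋂ {Ker f | f ∈ Hom_R(M, K)}` of a module `K` in `M`. -/
def annIn (R : Type u) [Ring R] (M : Type v) [AddCommGroup M] [Module R M]
    (K : Type v) [AddCommGroup K] [Module R K] : Submodule R M :=
  ⨅ f : M →ₗ[R] K, LinearMap.ker f

/-- The algebraic De Morgan law for a module: `Ann_M(N ∩ L) = Ann_M(N) + Ann_M(L)` for all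
fully invariant submodules `N`, `L`. -/
def ModuleDML (R : Type u) [Ring R] (M : Type v) [AddCommGroup M] [Module R M] : Prop :=
  ∀ N L : Submodule R M, N.IsFullyInvariant → L.IsFullyInvariant →
    annIn R M ↥(N ⊓ L) = annIn R M ↥N ⊔ annIn R M ↥L

/-- `Ψ(M)`: the fully invariant submodules `N` with `N + Ann_M(Rn) = M` for all `n ∈ N`. -/
def modPsi (R : Type u) [Ring R] (M : Type v) [AddCommGroup M] [Module R M] :
    Set (Submodule R M) :=
  {N | N.IsFullyInvariant ∧ ∀ n ∈ N, N ⊔ annIn R M ↥(Submodule.span R {n}) = ⊤}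

/-- De Morgan's law in a frame: `¬(a ∧ b) = ¬a ∨ ¬b`. -/
def FrameDML (Ω : Type v) [Order.Frame Ω] : Prop :=
  ∀ a b : Ω, (a ⊓ b)ᶜ = aᶜ ⊔ bᶜ

/-- A frame is regular if each `a` is the join of the `x` rather below `a`,
i.e. of the `x` with `a ∨ ¬x = 1`. -/
def FrameRegular (Ω : Type v) [Order.Frame Ω] : Prop :=
  ∀ a : Ω, a = sSup {x : Ω | a ⊔ xᶜ = ⊤}

variable {R : Type u} [Ring R] {M : Type v} [AddCommGroup M] [Module R M]

/-! Pseudocomplements in `Ψ(M)` are annihilators. Semiprimeness gives `Ann N ∩ N = 0`, and DML turns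
this into `Ann N + Ann (Ann N) = M`, which places `Ann N` in `Ψ(M)` (`annIn_mem_modPsi`). DML for
the frame is then DML for the module. For regularity, `n ∈ a` lies in `x = Ann (Ann (Rn))`, and `a +
Ann x ⊇ a + Ann (Rn) = M`.

Intersection need not distribute over sums of submodules, but projectivity makes the product do so
(`apply_mem_iSup_inf`). For `N ∈ Ψ(M)` and `n ∈ N`, self-generation and `N + Ann (Rn) = M` give `n ∈
N_M(Rn)`, so the law passes to intersections (`inf_iSup_le`). -/

theorem mem_annIn_iff {K : Submodule R M} {a : M} :
    a ∈ annIn R M K ↔ ∀ f : M →ₗ[R] M, (∀ m, f m ∈ K) → f a = 0 := by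
  simp only [annIn, Submodule.mem_iInf, LinearMap.mem_ker]
  refine ⟨fun h f hf => ?_, fun h f => ?_⟩
  · simpa using congrArg Subtype.val (h (f.codRestrict K hf))
  · exact Subtype.ext (h (K.subtype ∘ₗ f) fun m => (f m).2)

theorem annIn_anti {K L : Submodule R M} (h : K ≤ L) : annIn R M L ≤ annIn R M K :=
  fun _ ha => mem_annIn_iff.2 fun f hf => mem_annIn_iff.1 ha f fun m => h (hf m)

theorem annIn_isFullyInvariant (K : Submodule R M) : (annIn R M K).IsFullyInvariant :=
  fun g _ ha => mem_annIn_iff.2 fun f hf => mem_annIn_iff.1 ha (f ∘ₗ g) fun m => hf (g m)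

theorem annIn_bot : annIn R M (⊥ : Submodule R M) = ⊤ :=
  top_unique fun a _ => mem_annIn_iff.2 fun _ hf => hf a

/-- A fully invariant submodule meeting `K` trivially annihilates `K`. -/
theorem le_annIn_of_inf_eq_bot {N K : Submodule R M} (hN : N.IsFullyInvariant)
    (h : N ⊓ K = ⊥) : N ≤ annIn R M K := fun a ha => mem_annIn_iff.2 fun f hf =>
  (Submodule.mem_bot R).1 (h ▸ ⟨hN f ha, hf a⟩)

theorem Submodule.IsFullyInvariant.inf {N L : Submodule R M} (hN : N.IsFullyInvariant)
    (hL : L.IsFullyInvariant) : (N ⊓ L).IsFullyInvariant :=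
  fun f _ ha => ⟨hN f ha.1, hL f ha.2⟩

theorem Submodule.IsFullyInvariant.iSup {ι : Sort*} {x : ι → Submodule R M}
    (hx : ∀ i, (x i).IsFullyInvariant) : (⨆ i, x i).IsFullyInvariant :=
  fun f => iSup_le fun i => (hx i f).trans (Submodule.comap_mono (le_iSup x i))

/-- The fully invariant submodule generated by `K`. -/
def fullyInvariantClosure (K : Submodule R M) : Submodule R M :=
  ⨆ f : ULift.{v} (Module.End R M), K.map f.down

theorem le_fullyInvariantClosure (K : Submodule R M) : K ≤ fullyInvariantClosure K :=
  (Submodule.map_id K).ge.trans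
    (le_iSup (fun f : ULift.{v} (Module.End R M) => K.map f.down) ⟨LinearMap.id⟩)

theorem fullyInvariantClosure_isFullyInvariant (K : Submodule R M) :
    (fullyInvariantClosure K).IsFullyInvariant := by
  refine fun g => iSup_le fun f => ?_
  rintro _ ⟨k, hk, rfl⟩
  exact Submodule.mem_iSup_of_mem ⟨g ∘ₗ f.down⟩ ⟨k, hk, rfl⟩

/-! ### Consequences of projectivity in `σ[M]` -/

theorem modSubgenerated_of_injective {ι N : Type v} [AddCommGroup N] [Module R N]
    (i : N →ₗ[R] ι →₀ M) (hi : Function.Injective i) : ModSubgenerated R M N :=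
  ⟨ι →₀ M, inferInstance, inferInstance, i, ⟨ι, LinearMap.id, Function.surjective_id⟩, hi⟩

theorem modSubgenerated_submodule (N : Submodule R M) : ModSubgenerated R M N :=
  modSubgenerated_of_injective (Finsupp.lsingle (PUnit.unit : PUnit.{v + 1}) ∘ₗ N.subtype)
    ((Finsupp.single_injective _).comp N.injective_subtype)

/-- Lifting along a surjection `K → K.map f`. -/
theorem ProjectiveInSigma.lift_map (hM : ProjectiveInSigma R M) {K : Submodule R M}
    {f h : M →ₗ[R] M} (hh : ∀ m, h m ∈ K.map f) :
    ∃ g : M →ₗ[R] M, (∀ m, g m ∈ K) ∧ ∀ m, h m = f (g m) := by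
  obtain ⟨g, hg⟩ := hM K (K.map f) (modSubgenerated_submodule _) (modSubgenerated_submodule _)
    (f.submoduleMap K) (h.codRestrict _ hh) (f.submoduleMap_surjective K)
  exact ⟨K.subtype ∘ₗ g, fun m => (g m).2,
    fun m => congrArg Subtype.val (LinearMap.congr_fun hg m).symm⟩

/-- Lifting along the surjection from a direct sum of submodules onto their sum. -/
theorem ProjectiveInSigma.lift_iSup (hM : ProjectiveInSigma R M) {ι : Type v}
    {x : ι → Submodule R M} {h : M →ₗ[R] M} (hh : ∀ m, h m ∈ ⨆ i, x i) :
    ∃ g : M →ₗ[R] ι →₀ M, (∀ m i, g m i ∈ x i) ∧ ∀ m, h m = (g m).sum fun _ y => y := by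
  -- The direct sum of the `x i`, realised inside `M^(ι)` so that it lies in `σ[M]`.
  let A : Submodule R (ι →₀ M) := ⨅ i, (x i).comap (Finsupp.lapply i)
  have hA : ∀ c : ι →₀ M, c ∈ A ↔ ∀ i, c i ∈ x i := by simp [A, Submodule.mem_iInf]
  let s : (ι →₀ M) →ₗ[R] M := Finsupp.lsum ℕ fun _ => LinearMap.id
  have hs : ∀ c, s c = c.sum fun _ y => y := fun _ => rfl
  have hsA : ∀ c : A, (s ∘ₗ A.subtype) c ∈ ⨆ i, x i := fun c =>
    (Submodule.mem_iSup_iff_exists_finsupp _ _).2 ⟨c, (hA _).1 c.2, (hs c).symm⟩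
  obtain ⟨g, hg⟩ := hM A ↥(⨆ i, x i) (modSubgenerated_of_injective _ A.injective_subtype)
    (modSubgenerated_submodule _) ((s ∘ₗ A.subtype).codRestrict _ hsA) (h.codRestrict _ hh) (by
      rintro ⟨y, hy⟩
      obtain ⟨c, hc, rfl⟩ := (Submodule.mem_iSup_iff_exists_finsupp _ _).1 hy
      exact ⟨⟨c, (hA c).2 hc⟩, Subtype.ext (hs c)⟩)
  refine ⟨A.subtype ∘ₗ g, fun m => (hA _).1 (g m).2, fun m => ?_⟩
  rw [← hs]
  exact congrArg Subtype.val (LinearMap.congr_fun hg m).symm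

/-- The product with a fully invariant submodule distributes over sums. -/
theorem ProjectiveInSigma.apply_mem_iSup_inf (hM : ProjectiveInSigma R M) {ι : Type v}
    {x : ι → Submodule R M} {h : M →ₗ[R] M} (hh : ∀ m, h m ∈ ⨆ i, x i)
    {N : Submodule R M} (hN : N.IsFullyInvariant) {a : M} (ha : a ∈ N) :
    h a ∈ ⨆ i, N ⊓ x i := by
  obtain ⟨g, hg, hsum⟩ := hM.lift_iSup hh
  rw [hsum]
  exact sum_mem fun i _ => Submodule.mem_iSup_of_mem i
    ⟨hN (Finsupp.lapply i ∘ₗ g) ha, hg a i⟩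

theorem ProjectiveInSigma.apply_mem_sup_inf (hM : ProjectiveInSigma R M)
    {A B : Submodule R M} {h : M →ₗ[R] M} (hh : ∀ m, h m ∈ A ⊔ B)
    {N : Submodule R M} (hN : N.IsFullyInvariant) {a : M} (ha : a ∈ N) :
    h a ∈ (N ⊓ A) ⊔ (N ⊓ B) := by
  -- `ULift` moves the two-element index type into `Type v`, where the lifting lemma applies.
  have hsup : ∀ C : Bool → Submodule R M,
      (⨆ i : ULift.{v} Bool, C i.down) = C true ⊔ C false := fun C => by
    rw [iSup_ulift, iSup_bool_eq]
  have := hM.apply_mem_iSup_inf (x := fun i : ULift.{v} Bool => bif i.down then A else B)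
    (h := h) (by rw [hsup fun b => bif b then A else B]; exact hh) hN ha
  rwa [hsup fun b => N ⊓ bif b then A else B] at this

/-- Applied to the identity of `M = N + B`, distributivity gives `A ≤ (A ∩ N) + (A ∩ B)`. -/
theorem ProjectiveInSigma.sup_inf_eq_top (hM : ProjectiveInSigma R M) {N A B : Submodule R M}
    (hA : A.IsFullyInvariant) (h₁ : N ⊔ A = ⊤) (h₂ : N ⊔ B = ⊤) : N ⊔ (A ⊓ B) = ⊤ := by
  refine top_unique (h₁.ge.trans (sup_le le_sup_left fun a ha => ?_))
  have := hM.apply_mem_sup_inf (h := LinearMap.id) (fun m => h₂.ge (Submodule.mem_top (x := m)))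
    hA ha
  exact (sup_le_sup_right inf_le_right _ : A ⊓ N ⊔ A ⊓ B ≤ _) this

theorem ProjectiveInSigma.annIn_inf_le (hM : ProjectiveInSigma R M) (K L : Submodule R M) :
    annIn R M K ⊓ annIn R M L ≤ annIn R M ↥(K ⊔ L) := by
  refine fun a ha => mem_annIn_iff.2 fun f hf => ?_
  let x : ULift.{v} Bool → Submodule R M := fun i => bif i.down then K else L
  have hx : ⨆ i, x i = K ⊔ L := by
    rw [iSup_ulift, iSup_bool_eq]
    rfl
  obtain ⟨g, hg, hsum⟩ := hM.lift_iSup (x := x) (fun m => hx.ge (hf m))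
  rw [hsum]
  refine Finset.sum_eq_zero fun i _ => ?_
  have hi : a ∈ annIn R M (x i) := by
    rcases i with ⟨_ | _⟩
    exacts [ha.2, ha.1]
  exact mem_annIn_iff.1 hi (Finsupp.lapply i ∘ₗ g) fun m => hg m i

/-- A map into the closure splits into maps to the images `f(K)`. Each of these lifts through `f` to
a map into `K`, which kills `Ann K`. -/
theorem ProjectiveInSigma.annIn_le_annIn_closure (hM : ProjectiveInSigma R M)
    (K : Submodule R M) : annIn R M K ≤ annIn R M (fullyInvariantClosure K) := by
  refine fun a ha => mem_annIn_iff.2 fun h hh => ?_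
  obtain ⟨g, hg, hsum⟩ := hM.lift_iSup hh
  rw [hsum]
  refine Finset.sum_eq_zero fun f _ => ?_
  obtain ⟨k, hk, hfk⟩ := hM.lift_map (h := Finsupp.lapply f ∘ₗ g) fun m => hg m f
  exact (hfk a).trans (by rw [mem_annIn_iff.1 ha k hk, map_zero])

/-- With `L = Ann N ∩ N`, every map `M → L` is a map into `N`, hence kills `L ≤ Ann N`. So `L_M L =
0`. -/
theorem IsSemiprimeModule.annIn_inf_eq_bot (hsemi : IsSemiprimeModule R M)
    {N : Submodule R M} (hN : N.IsFullyInvariant) : annIn R M N ⊓ N = ⊥ := by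
  refine bot_unique (hsemi.2.2 _ ((annIn_isFullyInvariant _).inf hN) ?_)
  simp only [subProd, modProd, Submodule.map_iSup, iSup_le_iff]
  rintro f _ ⟨_, ⟨a, ha, rfl⟩, rfl⟩
  exact (Submodule.mem_bot R).2 (mem_annIn_iff.1 ha.1 (Submodule.subtype _ ∘ₗ f)
    fun m => (f m).2.2)

theorem IsSemiprimeModule.le_annIn_iff (hsemi : IsSemiprimeModule R M) {N L : Submodule R M}
    (hN : N.IsFullyInvariant) (hL : L.IsFullyInvariant) :
    L ≤ annIn R M N ↔ L ⊓ N = ⊥ :=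
  ⟨fun h => bot_unique ((inf_le_inf_right _ h).trans (hsemi.annIn_inf_eq_bot hN).le),
    le_annIn_of_inf_eq_bot hL⟩

/-- Semiprimeness handles fully invariant submodules only; a general `K` is replaced by its closure,
whose annihilator contains that of `K`. -/
theorem IsSemiprimeModule.le_annIn_annIn (hsemi : IsSemiprimeModule R M)
    (hM : ProjectiveInSigma R M) (K : Submodule R M) : K ≤ annIn R M (annIn R M K) := by
  refine (le_fullyInvariantClosure K).trans ((le_annIn_of_inf_eq_bot
    (fullyInvariantClosure_isFullyInvariant K) ?_).trans (annIn_anti (hM.annIn_le_annIn_closure K)))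
  rw [inf_comm]
  exact hsemi.annIn_inf_eq_bot (fullyInvariantClosure_isFullyInvariant K)

/-! ### Closure properties of `Ψ(M)` and distributivity -/

theorem mem_modPsi_bot : (⊥ : Submodule R M) ∈ modPsi R M := by
  refine ⟨fun f => bot_le, ?_⟩
  rintro n hn
  rw [Submodule.mem_bot] at hn
  subst hn
  rw [bot_sup_eq, Submodule.span_zero_singleton, annIn_bot]

theorem mem_modPsi_top : (⊤ : Submodule R M) ∈ modPsi R M :=
  ⟨fun _ _ _ => trivial, fun _ _ => top_sup_eq _⟩

theorem ProjectiveInSigma.inf_mem_modPsi (hM : ProjectiveInSigma R M) {N L : Submodule R M}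
    (hN : N ∈ modPsi R M) (hL : L ∈ modPsi R M) : N ⊓ L ∈ modPsi R M := by
  refine ⟨hN.1.inf hL.1, fun n hn => ?_⟩
  rw [sup_comm]
  refine hM.sup_inf_eq_top hN.1 ?_ ?_ <;> rw [sup_comm]
  exacts [hN.2 n hn.1, hL.2 n hn.2]

theorem ProjectiveInSigma.iSup_mem_modPsi (hM : ProjectiveInSigma R M) {ι : Sort*}
    {x : ι → Submodule R M} (hx : ∀ i, x i ∈ modPsi R M) : ⨆ i, x i ∈ modPsi R M := by
  refine ⟨.iSup fun i => (hx i).1, fun n hn => ?_⟩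
  refine Submodule.iSup_induction x
    (motive := fun n => (⨆ i, x i) ⊔ annIn R M (Submodule.span R {n}) = ⊤) hn ?_ ?_ ?_
  · exact fun i n hn =>
      top_unique (((hx i).2 n hn).ge.trans (sup_le_sup_right (le_iSup x i) _))
  · rw [Submodule.span_zero_singleton, annIn_bot, sup_top_eq]
  · intro n m hn hm
    -- Additivity rests on `Ann (Rn) ∩ Ann (Rm) ≤ Ann (Rn + Rm) ≤ Ann (R(n + m))`.
    refine top_unique ((hM.sup_inf_eq_top (annIn_isFullyInvariant _) hn hm).ge.trans
      (sup_le_sup_left ((hM.annIn_inf_le _ _).trans (annIn_anti ?_)) _))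
    rw [Submodule.span_singleton_le_iff_mem]
    exact add_mem (Submodule.mem_sup_left (Submodule.mem_span_singleton_self n))
      (Submodule.mem_sup_right (Submodule.mem_span_singleton_self m))

theorem ProjectiveInSigma.sup_mem_modPsi (hM : ProjectiveInSigma R M) {N L : Submodule R M}
    (hN : N ∈ modPsi R M) (hL : L ∈ modPsi R M) : N ⊔ L ∈ modPsi R M := by
  have h := hM.iSup_mem_modPsi (x := fun i => bif i then N else L) fun i => by
    cases i
    exacts [hL, hN]
  rwa [iSup_bool_eq] at h

/-- An element `n` of `N ∈ Ψ(M)` lies in the product of `N` with the submodule generated by `n`. -/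
theorem IsSelfProgenerator.mem_of_mem_modPsi (hM : IsSelfProgenerator R M) {N K : Submodule R M}
    (hN : N ∈ modPsi R M) {n : M} (hn : n ∈ N)
    (hK : ∀ f : M →ₗ[R] M, (∀ m, f m ∈ Submodule.span R {n}) → ∀ a ∈ N, f a ∈ K) : n ∈ K := by
  obtain ⟨X, ρ, hρ⟩ := hM.2 (Submodule.span R {n})
  obtain ⟨c, hc⟩ := hρ ⟨n, Submodule.mem_span_singleton_self n⟩
  have key : ∀ i m, (ρ (Finsupp.single i m) : M) ∈ K := fun i m => by
    let f : M →ₗ[R] M := Submodule.subtype _ ∘ₗ ρ ∘ₗ Finsupp.lsingle i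
    have hf : ∀ m, f m ∈ Submodule.span R {n} := fun m => (ρ (Finsupp.single i m)).2
    -- Since `M = N + Ann (Rn)` and `f` maps into `Rn`, only the component in `N` survives.
    obtain ⟨e, he, z, hz, rfl⟩ := Submodule.mem_sup.1
      ((hN.2 n hn).ge (Submodule.mem_top (x := m)))
    change f (e + z) ∈ K
    rw [map_add, mem_annIn_iff.1 hz f hf, add_zero]
    exact hK f hf e he
  have hall : ∀ c, (ρ c : M) ∈ K := fun c => by
    induction c using Finsupp.induction_linear with
    | zero => simp
    | add c d hc hd => simpa using add_mem hc hd
    | single i m => exact key i m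
  simpa [hc] using hall c

theorem IsSelfProgenerator.inf_iSup_le (hM : IsSelfProgenerator R M) {ι : Type v}
    {N : Submodule R M} (hN : N ∈ modPsi R M) {x : ι → Submodule R M} :
    N ⊓ ⨆ i, x i ≤ ⨆ i, N ⊓ x i := by
  refine fun n hn => hM.mem_of_mem_modPsi hN hn.1 fun f hf a ha => ?_
  refine hM.1.apply_mem_iSup_inf (fun m => ?_) hN.1 ha
  exact (Submodule.span_singleton_le_iff_mem _ _).2 hn.2 (hf m)

theorem annIn_mem_modPsi (hsemi : IsSemiprimeModule R M) (hDML : ModuleDML R M)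
    {N : Submodule R M} (hN : N.IsFullyInvariant) : annIn R M N ∈ modPsi R M := by
  refine ⟨annIn_isFullyInvariant _, fun n hn => ?_⟩
  have h := hDML _ _ hN (annIn_isFullyInvariant N)
  rw [inf_comm, hsemi.annIn_inf_eq_bot hN, annIn_bot] at h
  exact top_unique (h.le.trans (sup_le_sup_left
    (annIn_anti ((Submodule.span_singleton_le_iff_mem _ _).2 hn)) _))

/-- `Ψ(M)` as a complete lattice, with sums as joins and intersections as binary meets. -/
abbrev modPsiCompleteLattice (hM : ProjectiveInSigma R M) : CompleteLattice (modPsi R M) :=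
  letI : SupSet (modPsi R M) :=
    ⟨fun s => ⟨⨆ b : s, b.1.1, hM.iSup_mem_modPsi fun b => b.1.2⟩⟩
  { completeLatticeOfSup (modPsi R M) (fun s =>
      ⟨fun a ha => le_iSup (fun b : s => b.1.1) ⟨a, ha⟩,
        fun a ha => (iSup_le fun b => ha b.2 :
          (⨆ b : s, b.1.1) ≤ a)⟩) with
    -- Finite meets and joins are given explicitly, so that they are definitionally those of
    -- submodules; infinite meets remain joins of lower bounds.
    inf := fun a b => ⟨a.1 ⊓ b.1, hM.inf_mem_modPsi a.2 b.2⟩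
    inf_le_left := fun a b => (inf_le_left : a.1 ⊓ b.1 ≤ a.1)
    inf_le_right := fun a b => (inf_le_right : a.1 ⊓ b.1 ≤ b.1)
    le_inf := fun a b c hb hc => (le_inf hb hc : a.1 ≤ b.1 ⊓ c.1)
    sup := fun a b => ⟨a.1 ⊔ b.1, hM.sup_mem_modPsi a.2 b.2⟩
    le_sup_left := fun a b => (le_sup_left : a.1 ≤ a.1 ⊔ b.1)
    le_sup_right := fun a b => (le_sup_right : b.1 ≤ a.1 ⊔ b.1)
    sup_le := fun a b c hb hc => (sup_le hb hc : a.1 ⊔ b.1 ≤ c.1)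
    top := ⟨⊤, mem_modPsi_top⟩
    le_top := fun a => (le_top : (a : Submodule R M) ≤ ⊤)
    bot := ⟨⊥, mem_modPsi_bot⟩
    bot_le := fun a => (bot_le : ⊥ ≤ (a : Submodule R M)) }

/-- `Ψ(M)` as a frame. -/
abbrev modPsiFrame (hM : IsSelfProgenerator R M) : Order.Frame (modPsi R M) :=
  letI := modPsiCompleteLattice hM.1
  Order.Frame.ofMinimalAxioms
    { inf_sSup_le_iSup_inf := fun a s => by
        rw [iSup_subtype', ← sSup_range]
        change (a : Submodule R M) ⊓ (⨆ b : s, b.1.1) ≤ _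
        refine (hM.inf_iSup_le a.2).trans (iSup_le fun b => ?_)
        exact le_sSup (α := modPsi R M) (Set.mem_range_self (f := fun b : s => a ⊓ b.1) b) }

theorem coe_compl_modPsi (hM : IsSelfProgenerator R M) (hsemi : IsSemiprimeModule R M)
    (hDML : ModuleDML R M) (a : modPsi R M) :
    letI := modPsiFrame hM
    ((aᶜ : modPsi R M) : Submodule R M) = annIn R M (a : Submodule R M) := by
  let := modPsiFrame hM
  apply le_antisymm
  · refine (hsemi.le_annIn_iff a.2.1 (aᶜ).2.1).2 ?_
    exact congrArg Subtype.val (compl_inf_self a)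
  · let b : modPsi R M := ⟨annIn R M a.1, annIn_mem_modPsi hsemi hDML a.2.1⟩
    have hb : b ≤ aᶜ := le_compl_iff_disjoint_right.2 (disjoint_iff.2
      (Subtype.ext (hsemi.annIn_inf_eq_bot a.2.1)))
    exact hb

theorem mainTheorem8 (R : Type u) [Ring R] (M : Type v) [AddCommGroup M] [Module R M]
    (hM : IsSelfProgenerator R M) (hsemi : IsSemiprimeModule R M) (hDML : ModuleDML R M) :
    ∃ F : Order.Frame ↥(modPsi R M),
      (∀ N L : ↥(modPsi R M), F.le N L ↔ (N : Submodule R M) ≤ (L : Submodule R M)) ∧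
      @FrameDML ↥(modPsi R M) F ∧ @FrameRegular ↥(modPsi R M) F := by
  let := modPsiFrame hM
  have hc := coe_compl_modPsi hM hsemi hDML
  refine ⟨modPsiFrame hM, fun _ _ => Iff.rfl, fun a b => Subtype.ext ?_, fun a => ?_⟩
  · refine (hc _).trans ((hDML _ _ a.2.1 b.2.1).trans ?_)
    rw [← hc a, ← hc b]
    rfl
  · apply le_antisymm
    · intro n hn
      let A := annIn R M (Submodule.span R {n})
      have hA : A.IsFullyInvariant := annIn_isFullyInvariant _
      let x : modPsi R M := ⟨annIn R M A, annIn_mem_modPsi hsemi hDML hA⟩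
      have hx : a ⊔ xᶜ = ⊤ := by
        -- As `¬x = Ann (Ann A)` contains `A`, the defining condition `a + A = M` suffices.
        refine Subtype.ext (top_unique ((a.2.2 n hn).ge.trans (sup_le_sup_left ?_ _)))
        rw [hc x]
        exact hsemi.le_annIn_annIn hM.1 A
      have hle : x ≤ sSup {x | a ⊔ xᶜ = ⊤} := le_sSup hx
      exact hle (hsemi.le_annIn_annIn hM.1 _ (Submodule.mem_span_singleton_self n))
    · refine sSup_le fun x hx => ?_
      have hx : a ⊔ xᶜ = ⊤ := hx
      calc x = x ⊓ (a ⊔ xᶜ) := by rw [hx, inf_top_eq]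
        _ = x ⊓ a := by rw [inf_sup_left, inf_compl_self, sup_bot_eq]
        _ ≤ a := inf_le_right
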